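/- Let $R$ be an associative ring with unit, let $R\text{-Mod}$ be the category of left $R$-modules, and let $n\ge 0$ be an integer or $n=\infty$. For finite $n$, let $\mathcal{FP}_n$ be the class of modules $M$ admitting an exact sequence $F_n\to\cdots\to F_1\to F_0\to M\to 0$ with every $F_i$ finitely generated and free; let $\mathcal{FP}_\infty$ be the class of modules $M$ admitting an exact sequence $\cdots\to F_1\to F_0\to M\to 0$ with every $F_i$ finitely generated and free. For a class $\mathcal C$ of modules put $\mathcal C^{\perp}=\{X : \mathrm{Ext}^1_R(C,X)=0 \text{ for all } C\in\mathcal C\}$ and ${}^{\perp}\mathcal C=\{X : \mathrm{Ext}^1_R(X,C)=0\text{ for all } C\in\mathcal C\}$, and let $\mathcal{FP}_n\text{-Inj}=(\mathcal{FP}_n)^{\perp}$ be the class of $\mathrm{FP}_n$-injective modules. Write $\mathcal B=\mathcal{FP}_n\text{-Inj}$ and $\mathcal A={}^{\perp}\mathcal B$. Then $(\mathcal A,\mathcal B)$ is a complete cotorsion pair in $R\text{-Mod}$, that is: 1. $\mathcal A^{\perp}=\mathcal B$ and $\mathcal A={}^{\perp}\mathcal B$; 2. for every $R$-module $X$ there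 are short exact sequences $0\to B\to A\to X\to 0$ and $0\to X\to B'\to A'\to 0$ with $A,A'\in\mathcal A$ and $B,B'\in\mathcal B$. Moreover, this cotorsion pair is cogenerated by a set: there is a set $\mathcal S$ of $R$-modules with $\mathcal B=\mathcal S^{\perp}$. -/

import Mathlib

open CategoryTheory

universe u

namespace FPInj

variable {R : Type u} [Ring R]

/-- `M` is finitely `n`-presented, for `n` a natural number or `∞`: there is an exact sequence
`F n → ⋯ → F 1 → F 0 → M → 0` with all `F i` (`i ≤ n`) finitely generated and free; for `n = ∞`
this is a resolution `⋯ → F 1 → F 0 → M → 0` by finitely generated free modules.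
The terms and maps of the sequences below with index beyond `n` are not constrained. -/
def FP (n : ℕ∞) : ObjectProperty (ModuleCat.{u} R) := fun M =>
  ∃ (F : ℕ → ModuleCat.{u} R) (d : ∀ i, F (i + 1) ⟶ F i) (ε : F 0 ⟶ M),
    (∀ i : ℕ, (i : ℕ∞) ≤ n → Module.Finite R (F i) ∧ Module.Free R (F i)) ∧
    Function.Surjective ε ∧
    (1 ≤ n → Function.Exact (d 0) ε) ∧
    (∀ i : ℕ, ((i + 2 : ℕ) : ℕ∞) ≤ n → Function.Exact (d (i + 1)) (d i))

/-- The right orthogonal complement `𝒞^⊥ = {X | Ext¹(C, X) = 0 for all C ∈ 𝒞}`. -/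
def rightPerp (C : ObjectProperty (ModuleCat.{u} R)) : ObjectProperty (ModuleCat.{u} R) :=
  fun X => ∀ Y, C Y → Subsingleton (Abelian.Ext Y X 1)

/-- The left orthogonal complement `^⊥𝒞 = {X | Ext¹(X, C) = 0 for all C ∈ 𝒞}`. -/
def leftPerp (C : ObjectProperty (ModuleCat.{u} R)) : ObjectProperty (ModuleCat.{u} R) :=
  fun X => ∀ Y, C Y → Subsingleton (Abelian.Ext X Y 1)

/-- The class of `FP_n`-injective modules: those `M` with `Ext¹(F, M) = 0` for all finitely
`n`-presented `F`. -/
def FPInjective (n : ℕ∞) : ObjectProperty (ModuleCat.{u} R) :=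
  fun M => ∀ F : ModuleCat.{u} R, FP n F → Subsingleton (Abelian.Ext F M 1)

/-- `(𝒜, ℬ)` is a cotorsion pair. -/
structure IsCotorsionPair (A B : ObjectProperty (ModuleCat.{u} R)) : Prop where
  rightPerp_eq : rightPerp A = B
  eq_leftPerp : A = leftPerp B

/-- `(𝒜, ℬ)` is a complete cotorsion pair: a cotorsion pair such that every module `X` admits
short exact sequences `0 → B → A → X → 0` and `0 → X → B' → A' → 0` with `A, A' ∈ 𝒜` and
`B, B' ∈ ℬ`. -/
structure IsCompleteCotorsionPair (A B : ObjectProperty (ModuleCat.{u} R)) : Prop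
    extends IsCotorsionPair A B where
  exists_left : ∀ X : ModuleCat.{u} R, ∃ (K P : ModuleCat.{u} R) (f : K ⟶ P) (g : P ⟶ X)
    (w : f ≫ g = 0), (ShortComplex.mk f g w).ShortExact ∧ B K ∧ A P
  exists_right : ∀ X : ModuleCat.{u} R, ∃ (E L : ModuleCat.{u} R) (f : X ⟶ E) (g : E ⟶ L)
    (w : f ≫ g = 0), (ShortComplex.mk f g w).ShortExact ∧ B E ∧ A L

/-- The class `ℬ` (the right half of a cotorsion pair) is cogenerated by a set: `ℬ = 𝒮^⊥` for
some set `𝒮` of modules, given here as a family indexed by a small type. -/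
def IsCogeneratedBySet (B : ObjectProperty (ModuleCat.{u} R)) : Prop :=
  ∃ (ι : Type u) (S : ι → ModuleCat.{u} R), B = rightPerp (fun X => ∃ i, X = S i)

end FPInj

/-! Up to isomorphism the `FP n` modules form a set, the quotients `Rᵏ/N`, so they cogenerate `ℬ`.
As `Rᵏ` is projective, `Ext¹(Rᵏ/N, Y) = 0` means that every map `N → Y` extends to `Rᵏ`. Hence an
epimorphism has kernel in `ℬ` exactly when it lifts against all inclusions `N → Rᵏ`
(`rlp_inclusions_of_shortExact`, `fpInjective_X₁_of_rlp_inclusions`), and the cokernel of a map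
lifting against all such epimorphisms lies in `𝒜` (`leftPerp_of_llp`). The small object argument,
applied to `0 → X` and to `X → 0`, then gives the two approximation sequences. -/

namespace CategoryTheory

open Limits MorphismProperty ZeroObject

universe w v u'

variable {C : Type u'} [Category.{v} C] [Abelian C]

/-- In a Grothendieck abelian category, every small class of monomorphisms permits the small
object argument. -/
lemma IsGrothendieckAbelian.hasSmallObjectArgument_of_le_monomorphisms
    [IsGrothendieckAbelian.{w} C] (I : MorphismProperty C) [MorphismProperty.IsSmall.{w} I]
    (hI : I ≤ monomorphisms C) : HasSmallObjectArgument.{w} I := by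
  -- Once `κ` exceeds the number of subobjects of each domain, maps out of the domains commute with
  -- `κ`-indexed compositions of monomorphisms.
  obtain ⟨κ, hκ', hκ⟩ := HasCardinalLT.exists_regular_cardinal_forall.{w}
    (fun f : I.toSet ↦ Subobject (f : Arrow C).left)
  have : Fact κ.IsRegular := ⟨hκ'⟩
  have : Nonempty κ.ord.ToType := by simpa using hκ'.ne_zero
  have := WellFoundedLT.toOrderBot κ.ord.ToType
  exact ⟨κ, inferInstance, inferInstance,
    { preservesColimit {A B X Y} i hi f hf := by
        let hf' : (monomorphisms C).TransfiniteCompositionOfShape κ.ord.ToType f :=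
          { toTransfiniteCompositionOfShape := hf.toTransfiniteCompositionOfShape
            map_mem j hj := by
              have := (hf.attachCells j hj).pushouts_coproducts
              simp only [ofHoms_homFamily] at this
              refine (?_ : _ ≤ monomorphisms C) _ this
              simp only [pushouts_le_iff, coproducts_le_iff]
              exact hI }
        have (j j' : κ.ord.ToType) (φ : j ⟶ j') : Mono (hf'.F.map φ) := hf'.mem_map φ
        exact IsGrothendieckAbelian.preservesColimit_coyoneda_obj_of_mono (Y := hf'.F) (κ := κ)
          (hκ ⟨Arrow.mk i, hi⟩) }⟩

namespace ShortComplex.ShortExact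

variable [HasExt.{w} C] {S : ShortComplex C}

lemma subsingleton_ext_X₃_iff [Projective S.X₂] (hS : S.ShortExact) (Y : C) :
    Subsingleton (Abelian.Ext S.X₃ Y 1) ↔
      ∀ f : S.X₁ ⟶ Y, ∃ g : S.X₂ ⟶ Y, S.f ≫ g = f := by
  constructor
  · intro h f
    obtain ⟨x, hx⟩ := Abelian.Ext.contravariant_sequence_exact₁ hS Y (Abelian.Ext.mk₀ f)
      (add_zero 1) (Subsingleton.elim _ _)
    obtain ⟨g, rfl⟩ := Abelian.Ext.addEquiv₀.symm.surjective x
    refine ⟨g, ?_⟩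
    apply Abelian.Ext.addEquiv₀.symm.injective
    simpa using hx
  · intro h
    refine subsingleton_of_forall_eq 0 fun x ↦ ?_
    obtain ⟨y, rfl⟩ := Abelian.Ext.contravariant_sequence_exact₃ hS Y x
      (Abelian.Ext.eq_zero_of_projective _) (add_zero 1)
    obtain ⟨f, rfl⟩ := Abelian.Ext.addEquiv₀.symm.surjective y
    obtain ⟨g, rfl⟩ := h f
    simp [← Abelian.Ext.mk₀_comp_mk₀]

lemma subsingleton_ext_X₁_of_lift [Injective S.X₂] (hS : S.ShortExact) (X : C)
    (h : ∀ f : X ⟶ S.X₃, ∃ g : X ⟶ S.X₂, g ≫ S.g = f) :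
    Subsingleton (Abelian.Ext X S.X₁ 1) := by
  refine subsingleton_of_forall_eq 0 fun x ↦ ?_
  obtain ⟨y, rfl⟩ := Abelian.Ext.covariant_sequence_exact₁ X hS x
    (Abelian.Ext.eq_zero_of_injective _) (zero_add 1)
  obtain ⟨f, rfl⟩ := Abelian.Ext.addEquiv₀.symm.surjective y
  obtain ⟨g, rfl⟩ := h f
  simp [← Abelian.Ext.mk₀_comp_mk₀]

/-- If `S : 0 → N → P → M → 0` is exact with `P` projective, then `N → P` has the left lifting
property with respect to epimorphisms whose kernel `K` satisfies `Ext¹(M, K) = 0`. -/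
lemma hasLiftingProperty [Projective S.X₂] (hS : S.ShortExact) {T : ShortComplex C}
    (hT : T.ShortExact) [Subsingleton (Abelian.Ext S.X₃ T.X₁ 1)] :
    HasLiftingProperty S.f T.g where
  sq_hasLift {a b} sq := by
    have := hT.mono_f
    have := hT.epi_g
    let l := Projective.factorThru b T.g
    have hl : l ≫ T.g = b := Projective.factorThru_comp _ _
    -- An arbitrary lift `l` of `b` misses `a` by a map into the kernel; extending that error to
    -- `S.X₂` corrects `l`.
    let k := hT.exact.lift (a - S.f ≫ l) (by simp [sq.w, hl])
    have hk : k ≫ T.f = a - S.f ≫ l := hT.exact.lift_f _ _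
    obtain ⟨g, hg⟩ := (hS.subsingleton_ext_X₃_iff T.X₁).1 inferInstance k
    exact ⟨⟨l + g ≫ T.f, by simp [reassoc_of% hg, hk], by simp [hl]⟩⟩

end ShortComplex.ShortExact

/-- Let `X → E → L → 0` be exact. If `X → E` has the left lifting property with respect to
all epimorphisms with kernel `Y`, then `Ext¹(L, Y) = 0`. -/
lemma ShortComplex.Exact.subsingleton_ext_of_hasLiftingProperty [HasExt.{w} C]
    [EnoughInjectives C] {S : ShortComplex C} (hS : S.Exact) [Epi S.g] (Y : C)
    (h : ∀ (T : ShortComplex C), T.ShortExact → T.X₁ = Y → HasLiftingProperty S.f T.g) :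
    Subsingleton (Abelian.Ext S.X₃ Y 1) := by
  let T := ShortComplex.mk (Injective.ι Y) _ (cokernel.condition (Injective.ι Y))
  have hT : T.ShortExact :=
    { exact := ShortComplex.exact_of_g_is_cokernel _ (cokernelIsCokernel T.f) }
  have : Injective T.X₂ := inferInstanceAs (Injective (Injective.under Y))
  refine hT.subsingleton_ext_X₁_of_lift S.X₃ fun f ↦ ?_
  have := h T hT rfl
  -- With zero on top, the diagonal kills `S.f` and so descends to `S.X₃`.
  have sq : CommSq (0 : S.X₁ ⟶ T.X₂) S.f T.g (S.g ≫ f) := ⟨by simp⟩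
  refine ⟨hS.desc sq.lift sq.fac_left, ?_⟩
  rw [← cancel_epi S.g, hS.g_desc_assoc, sq.fac_right]

end CategoryTheory

namespace FPInj

open Limits MorphismProperty ZeroObject

variable {R : Type u} [Ring R] {n : ℕ∞}

lemma FP.of_iso {M N : ModuleCat.{u} R} (h : FP n M) (e : M ≅ N) : FP n N := by
  obtain ⟨F, d, ε, hF, hε, h₁, h₂⟩ := h
  refine ⟨F, d, ε ≫ e.hom, hF, ?_, fun hn x ↦ ?_, h₂⟩
  · exact e.toLinearEquiv.surjective.comp hε
  · rw [← h₁ hn x]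
    exact e.toLinearEquiv.map_eq_zero_iff

lemma FP.finite {M : ModuleCat.{u} R} (h : FP n M) : Module.Finite R M := by
  obtain ⟨F, d, ε, hF, hε, -⟩ := h
  have := (hF 0 (by simp)).1
  exact Module.Finite.of_surjective ε.hom hε

lemma FP.of_finite_free (M : ModuleCat.{u} R) [Module.Finite R M] [Module.Free R M] :
    FP n M := by
  refine ⟨fun i ↦ Nat.casesOn i M fun _ ↦ ModuleCat.of R PUnit.{u + 1}, fun i ↦ 0, 𝟙 M, ?_,
    fun x ↦ ⟨x, rfl⟩, ?_, ?_⟩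
  · rintro (_ | i) -
    · exact ⟨inferInstance, inferInstance⟩
    · exact ⟨inferInstanceAs (Module.Finite R PUnit.{u + 1}), inferInstanceAs (Module.Free R PUnit.{u + 1})⟩
  · intro _ x
    constructor
    · intro hx
      exact ⟨0, by simpa using hx.symm⟩
    · rintro ⟨y, rfl⟩
      simp
  · intro i _ x
    exact ⟨fun _ ↦ ⟨0, rfl⟩, fun _ ↦ rfl⟩

variable (R n) in
/-- Submodules of finite free modules `Rᵏ` whose quotient is finitely `n`-presented. -/
abbrev Relations : Type u :=
  Σ k : ℕ, { N : Submodule R (Fin k → R) // FP n (ModuleCat.of R ((Fin k → R) ⧸ N)) }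

/-- The quotient of `Rᵏ` by a submodule of relations. -/
abbrev Relations.quotient (r : Relations R n) : ModuleCat.{u} R :=
  ModuleCat.of R ((Fin r.1 → R) ⧸ r.2.1)

/-- The short complex `0 → N → Rᵏ → Rᵏ/N → 0`. -/
abbrev Relations.shortComplex (r : Relations R n) : ShortComplex (ModuleCat.{u} R) :=
  ShortComplex.mk (ModuleCat.ofHom r.2.1.subtype) (ModuleCat.ofHom r.2.1.mkQ) (by
    ext x
    exact (Submodule.Quotient.mk_eq_zero _).2 x.2)

lemma Relations.shortExact (r : Relations R n) : r.shortComplex.ShortExact where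
  exact := by
    rw [ShortComplex.ShortExact.moduleCat_exact_iff_function_exact]
    exact LinearMap.exact_subtype_mkQ r.2.1
  mono_f := (ModuleCat.mono_iff_injective _).2 r.2.1.injective_subtype
  epi_g := (ModuleCat.epi_iff_surjective _).2 r.2.1.mkQ_surjective

instance (r : Relations R n) : Projective r.shortComplex.X₂ :=
  ModuleCat.projective_of_categoryTheory_projective (ModuleCat.of R (Fin r.1 → R))

/-- Any surjection `Rᵏ → M` will do, since `Relations` constrains only the quotient. -/
lemma FP.exists_relations {M : ModuleCat.{u} R} (h : FP n M) :
    ∃ r : Relations R n, Nonempty (M ≅ r.quotient) := by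
  have := h.finite
  obtain ⟨k, f, hf⟩ := Module.Finite.exists_fin' R M
  let e : M ≅ ModuleCat.of R ((Fin k → R) ⧸ LinearMap.ker f) :=
    (f.quotKerEquivOfSurjective hf).symm.toModuleIso
  exact ⟨⟨k, _, h.of_iso e⟩, ⟨e⟩⟩

lemma subsingleton_ext_of_iso {M N : ModuleCat.{u} R} (e : M ≅ N) (Y : ModuleCat.{u} R)
    [Subsingleton (Abelian.Ext N Y 1)] : Subsingleton (Abelian.Ext M Y 1) := by
  refine subsingleton_of_forall_eq 0 fun x ↦ ?_
  have h : (Abelian.Ext.mk₀ e.inv).comp x (zero_add 1) = 0 := Subsingleton.elim _ _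
  rw [← Abelian.Ext.mk₀_id_comp x, ← e.hom_inv_id, ← Abelian.Ext.mk₀_comp_mk₀_assoc, h,
    Abelian.Ext.comp_zero]

lemma fpInjective_eq_rightPerp :
    FPInjective (R := R) n = rightPerp (fun X ↦ ∃ r : Relations R n, X = r.quotient) := by
  ext Y
  constructor
  · rintro h _ ⟨r, rfl⟩
    exact h _ r.2.2
  · intro h M hM
    obtain ⟨r, ⟨e⟩⟩ := hM.exists_relations
    have := h _ ⟨r, rfl⟩
    exact subsingleton_ext_of_iso e Y

lemma fpInjective_iff_extend (Y : ModuleCat.{u} R) :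
    FPInjective n Y ↔ ∀ (r : Relations R n) (f : r.shortComplex.X₁ ⟶ Y),
      ∃ g : r.shortComplex.X₂ ⟶ Y, r.shortComplex.f ≫ g = f := by
  rw [fpInjective_eq_rightPerp]
  constructor
  · intro h r
    exact (r.shortExact.subsingleton_ext_X₃_iff Y).1 (h _ ⟨r, rfl⟩)
  · rintro h _ ⟨r, rfl⟩
    exact (r.shortExact.subsingleton_ext_X₃_iff Y).2 (h r)

variable (R n) in
/-- The inclusions of the submodules of relations into the finite free modules. -/
def inclusions : MorphismProperty (ModuleCat.{u} R) :=
  ofHoms fun r : Relations R n ↦ r.shortComplex.f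

instance : HasSmallObjectArgument.{u} (inclusions R n) := by
  have : MorphismProperty.IsSmall.{u} (inclusions R n) := by
    dsimp [inclusions]
    infer_instance
  refine IsGrothendieckAbelian.hasSmallObjectArgument_of_le_monomorphisms _ ?_
  rintro _ _ _ ⟨r⟩
  exact r.shortExact.mono_f

lemma rlp_inclusions_of_shortExact {T : ShortComplex (ModuleCat.{u} R)} (hT : T.ShortExact)
    (h : FPInjective n T.X₁) : (inclusions R n).rlp T.g := by
  rintro _ _ _ ⟨r⟩
  have : Subsingleton (Abelian.Ext r.shortComplex.X₃ T.X₁ 1) := h _ r.2.2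
  exact r.shortExact.hasLiftingProperty hT

lemma fpInjective_X₁_of_rlp_inclusions {T : ShortComplex (ModuleCat.{u} R)} (hT : T.ShortExact)
    (h : (inclusions R n).rlp T.g) : FPInjective n T.X₁ := by
  rw [fpInjective_iff_extend]
  intro r f
  have := hT.mono_f
  have := h _ ⟨r⟩
  have sq : CommSq (f ≫ T.f) r.shortComplex.f T.g 0 := ⟨by simp⟩
  refine ⟨hT.exact.lift sq.lift sq.fac_right, ?_⟩
  rw [← cancel_mono T.f, Category.assoc, hT.exact.lift_f, sq.fac_left]

/-- The inclusion `0 → R` is one of the generators, and lifting against it lifts elements. -/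
lemma epi_of_rlp_inclusions {A X : ModuleCat.{u} R} {p : A ⟶ X}
    (h : (inclusions R n).rlp p) : Epi p := by
  rw [ModuleCat.epi_iff_surjective]
  intro x
  let r : Relations R n := ⟨1, ⊥, by
    have := Module.Free.of_equiv (Submodule.quotEquivOfEqBot (⊥ : Submodule R (Fin 1 → R)) rfl).symm
    exact FP.of_finite_free _⟩
  have := h _ ⟨r⟩
  have sq : CommSq (0 : r.shortComplex.X₁ ⟶ A) r.shortComplex.f p
      (ModuleCat.ofHom (LinearMap.toSpanSingleton R X x ∘ₗ LinearMap.proj 0)) := ⟨by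
    ext ⟨y, hy⟩
    obtain rfl := (Submodule.mem_bot R).1 hy
    simp⟩
  refine ⟨sq.lift (fun _ ↦ (1 : R)), ?_⟩
  have := ConcreteCategory.congr_hom sq.fac_right (fun _ ↦ (1 : R))
  refine this.trans ?_
  change (1 : R) • (x : X) = x
  exact one_smul R x

lemma leftPerp_of_llp {S : ShortComplex (ModuleCat.{u} R)} (hS : S.Exact) [Epi S.g]
    (h : (inclusions R n).rlp.llp S.f) : leftPerp (FPInjective (R := R) n) S.X₃ := by
  intro Y hY
  refine hS.subsingleton_ext_of_hasLiftingProperty Y fun T hT e ↦ ?_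
  subst e
  exact h _ (rlp_inclusions_of_shortExact hT hY)

lemma fpInjective_of_injective (J : ModuleCat.{u} R) [Injective J] : FPInjective n J :=
  fun _ _ ↦ subsingleton_of_forall_eq 0 Abelian.Ext.eq_zero_of_injective

lemma shortExact_id_zero (E : ModuleCat.{u} R) :
    (ShortComplex.mk (𝟙 E) (0 : E ⟶ 0) (by simp)).ShortExact where
  exact := (ShortComplex.exact_iff_epi _ rfl).2 inferInstance
  mono_f := inferInstance
  epi_g := inferInstance

/-- An embedding of `X` into an injective `J` extends along `i`, because `J → 0` has kernel in `ℬ`.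
-/
lemma mono_of_llp {X E : ModuleCat.{u} R} {i : X ⟶ E} (h : (inclusions R n).rlp.llp i) :
    Mono i := by
  have := h _ (rlp_inclusions_of_shortExact (shortExact_id_zero (Injective.under X))
    (fpInjective_of_injective _))
  have sq : CommSq (Injective.ι X) i (0 : Injective.under X ⟶ 0) 0 := ⟨by simp⟩
  exact mono_of_mono_fac sq.fac_left

lemma exists_special_precover (X : ModuleCat.{u} R) :
    ∃ (K P : ModuleCat.{u} R) (f : K ⟶ P) (g : P ⟶ X) (w : f ≫ g = 0),
      (ShortComplex.mk f g w).ShortExact ∧ FPInjective n K ∧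
        leftPerp (FPInjective (R := R) n) P := by
  let φ := factorizationData (inclusions R n).rlp.llp (inclusions R n).rlp (0 : 0 ⟶ X)
  have := epi_of_rlp_inclusions φ.hp
  have hT : (ShortComplex.mk _ _ (kernel.condition φ.p)).ShortExact :=
    { exact := ShortComplex.exact_of_f_is_kernel _ (kernelIsKernel φ.p) }
  refine ⟨_, φ.Z, _, φ.p, _, hT, fpInjective_X₁_of_rlp_inclusions hT φ.hp, ?_⟩
  -- `φ.Z` is itself the cokernel of `0 → φ.Z`.
  let S := ShortComplex.mk φ.i (𝟙 φ.Z) ((isZero_zero _).eq_of_src _ _)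
  have : Epi S.g := inferInstanceAs (Epi (𝟙 φ.Z))
  exact leftPerp_of_llp (S := S)
    ((ShortComplex.exact_iff_mono _ ((isZero_zero _).eq_of_src _ _)).2
      (inferInstanceAs (Mono (𝟙 φ.Z)))) φ.hi

lemma exists_special_preenvelope (X : ModuleCat.{u} R) :
    ∃ (E L : ModuleCat.{u} R) (f : X ⟶ E) (g : E ⟶ L) (w : f ≫ g = 0),
      (ShortComplex.mk f g w).ShortExact ∧ FPInjective n E ∧
        leftPerp (FPInjective (R := R) n) L := by
  let φ := factorizationData (inclusions R n).rlp.llp (inclusions R n).rlp (0 : X ⟶ 0)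
  have := mono_of_llp φ.hi
  have hS : (ShortComplex.mk _ _ (cokernel.condition φ.i)).ShortExact :=
    { exact := ShortComplex.exact_of_g_is_cokernel _ (cokernelIsCokernel φ.i) }
  have := hS.epi_g
  refine ⟨φ.Z, _, φ.i, _, _, hS, ?_, leftPerp_of_llp hS.exact φ.hi⟩
  refine fpInjective_X₁_of_rlp_inclusions (shortExact_id_zero φ.Z) ?_
  have h : φ.p = 0 := (isZero_zero _).eq_of_tgt _ _
  have hp := φ.hp
  rw [h] at hp
  exact hp

/-- Formal: `FP n` modules lie in `𝒜`, so `𝒜^⊥ ⊆ ℬ`. -/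
lemma rightPerp_leftPerp_fpInjective :
    rightPerp (leftPerp (FPInjective (R := R) n)) = FPInjective n := by
  ext Y
  exact ⟨fun h M hM ↦ h M fun Z hZ ↦ hZ M hM, fun h M hM ↦ hM Y h⟩

end FPInj

theorem corollary4p2 (R : Type u) [Ring R] (n : ℕ∞) :
    FPInj.IsCompleteCotorsionPair
      (FPInj.leftPerp (FPInj.FPInjective (R := R) n)) (FPInj.FPInjective (R := R) n) ∧
    FPInj.IsCogeneratedBySet (FPInj.FPInjective (R := R) n) :=
  ⟨{ rightPerp_eq := FPInj.rightPerp_leftPerp_fpInjective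
     eq_leftPerp := rfl
     exists_left := FPInj.exists_special_precover
     exists_right := FPInj.exists_special_preenvelope },
    FPInj.Relations R n, FPInj.Relations.quotient, FPInj.fpInjective_eq_rightPerp⟩
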